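/- **Setting.** Let $G$ be a finite graph on a node set $V$ with symmetric nonnegative edge weights $w_{ij}$, let $\mathcal L=\mathcal D-\mathcal W$ be its Laplacian (with $\mathcal D$ the diagonal matrix of the degrees $\sum_j w_{ij}$), with eigenvalues $(\lambda^{\mathcal L}_i)_{i}$ and an orthonormal eigenbasis $(\mathbf q_i)_i$, let $\lambda>0$ be a regularization parameter, $\lambda_i=\lambda+\lambda_i^{\mathcal L}$, and let $K$ be the number of zero eigenvalues of $\mathcal L$. For a horizon $T\ge 1$ the effective dimension is $$\left\lceil \frac{\max\log\prod_{i}\bigl(1+t_i/\lambda_i\bigr)}{\log\bigl(1+T/(K\lambda)\bigr)}\right\rceil ,$$ the maximum being over all $t_i\ge 0$ with $\sum_i t_i=T$. The smoothness of $f:V\to\mathbb R$ is $S_G(f)=\frac12\sum_{i,j}w_{ij}(f(i)-f(j))^2$. A spectral bandit problem with $R$-sub-Gaussian noise consists of $G$, $\lambda$, $T$, a probability distribution of an unknown coefficient vector $\boldsymbol\alpha$, which defines the mean reward $f_{\boldsymbol\alpha}=\sum_i\alpha_i\mathbf q_i$, and a noise law: in each round $t\le T$ the algorithm picks a node $a_t$,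 possibly at random, depending on the past nodes and rewards (and on the problem, but not on $\boldsymbol\alpha$), and observes $r_t=f_{\boldsymbol\alpha}(a_t)+\varepsilon_t$, where, given $\boldsymbol\alpha$, the past and $a_t$, the noise $\varepsilon_t$ has a law that depends only on $(\boldsymbol\alpha,a_t)$, has mean zero and satisfies $\mathbb E\,e^{s\varepsilon_t}\le e^{R^2s^2/2}$ for all $s\in\mathbb R$. The expected regret is the expectation, over $\boldsymbol\alpha$, the noise and the internal randomization of the algorithm, of $T\max_v f_{\boldsymbol\alpha}(v)-\sum_{t=1}^T f_{\boldsymbol\alpha}(a_t)$. **Theorem.** For every $R>0$ there is a constant $c>0$, depending only on $R$, such that the following holds for every horizon $T\ge1$, every $d\ge2$, every $\lambda>0$ and every integer $M\ge T/d$. There is a spectral bandit problem with $R$-sub-Gaussian noise, horizon $T$ and regularization $\lambda$, whose graph is the disjoint union of $d$ complete graphs on $M$ vertices each, with all edge weights equal to one, such that 1. its effective dimension is exactly $d$; 2. almost surely $S_G(f_{\boldsymbol\alpha})=0$, i.e. the mean reward is constant on each of the complete graphs, and $0\le f_{\boldsymbol\alpha}\le\max\{1,\sqrt{d/T}\}$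 (in particular $0\le f_{\boldsymbol\alpha}\le 1$ if $d\le T$); 3. every algorithm has expected regret at least $c\sqrt{dT}$ on this problem. -/

import Mathlib

open MeasureTheory ProbabilityTheory
open scoped NNReal ENNReal

noncomputable section

/-- A finite undirected graph with nonnegative edge weights (similarities) `w_ij = w_ji`. -/
structure WeightedGraph (V : Type*) where
  weight : Matrix V V ℝ
  symm : weight.IsSymm
  nonneg : ∀ i j, 0 ≤ weight i j

namespace WeightedGraph

variable {V : Type*} [Fintype V] [DecidableEq V] (G : WeightedGraph V)

/-- The graph Laplacian: the diagonal matrix of weighted degrees minus the weight matrix. -/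
def laplacian : Matrix V V ℝ :=
  Matrix.diagonal (fun i => ∑ j, G.weight i j) - G.weight

theorem laplacian_isHermitian : G.laplacian.IsHermitian := by
  have h : G.laplacian.transpose = G.laplacian := by
    simp [laplacian, Matrix.transpose_sub, G.symm.eq]
  simpa [Matrix.IsHermitian, Matrix.conjTranspose_eq_transpose_of_trivial] using h

/-- The eigenvalues of the Laplacian, with multiplicity, indexed by the `|V|` elements of `V`. -/
def laplacianEigenvalue : V → ℝ := G.laplacian_isHermitian.eigenvalues

/-- The number of zero eigenvalues of the Laplacian. -/
def numZeroEigenvalues : ℕ :=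
  (Finset.univ.filter (fun i => G.laplacianEigenvalue i = 0)).card

/-- The function with coefficients `α` in an orthonormal eigenbasis `q` of the Laplacian,
`f_α(v) = ∑ k, α k * (q k) v`. -/
def signal (α : V → ℝ) (v : V) : ℝ :=
  ∑ k, α k * (G.laplacian_isHermitian.eigenvectorBasis k) v

/-- The smoothness `S_G(f) = 1/2 ∑ i j, w_ij (f i - f j)^2` of a function on the nodes. -/
def smoothness (f : V → ℝ) : ℝ :=
  (1 / 2) * ∑ i, ∑ j, G.weight i j * (f i - f j) ^ 2

/-- The effective dimension for horizon `T` and regularization `lam`: with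
`lam_i = lam + (i-th eigenvalue of the Laplacian)` and `K` the number of zero eigenvalues,
`⌈ (max log ∏ i, (1 + t_i / lam_i)) / log (1 + T / (K lam)) ⌉`, where the maximum is over all
`t ≥ 0` with `∑ i, t_i = T` (a compact set, so that the supremum is attained). -/
def effectiveDimension (lam : ℝ) (T : ℕ) : ℕ :=
  ⌈sSup {x : ℝ | ∃ t : V → ℝ, (∀ i, 0 ≤ t i) ∧ ∑ i, t i = T ∧
        x = Real.log (∏ i, (1 + t i / (lam + G.laplacianEigenvalue i)))} /
      Real.log (1 + T / (G.numZeroEigenvalues * lam))⌉₊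

end WeightedGraph

/-- `K` disjoint complete graphs, each on `M` vertices, all edges of weight one. -/
def blockGraph (K M : ℕ) : WeightedGraph (Fin K × Fin M) where
  weight := Matrix.of fun p q => if p.1 = q.1 ∧ p ≠ q then 1 else 0
  symm := by
    ext p q
    simp only [Matrix.transpose_apply, Matrix.of_apply]
    simp [eq_comm]
  nonneg := by
    intro p q
    simp only [Matrix.of_apply]
    split_ifs <;> norm_num

/-- A (randomized) bandit algorithm with arm set `V`: in round `t` (counted from `0`) it draws
an arm from a distribution that depends measurably on the `t` arms and rewards seen so far. -/
structure BanditAlgorithm (V : Type*) [MeasurableSpace V] where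
  policy : (t : ℕ) → Kernel (Fin t → V × ℝ) V
  isMarkov : ∀ t, IsMarkovKernel (policy t)

/-- The joint law of the first `t` arms and rewards, when the algorithm `A` plays against the
reward laws `ρ`: each reward has law `ρ a` given the past and the chosen arm `a`. -/
def historyLaw {V : Type*} [MeasurableSpace V] (A : BanditAlgorithm V) (ρ : Kernel V ℝ) :
    (t : ℕ) → Measure (Fin t → V × ℝ)
  | 0 => Measure.dirac (fun i => i.elim0)
  | t + 1 => ((historyLaw A ρ t) ⊗ₘ ((A.policy t) ⊗ₖ (Kernel.prodMkLeft (Fin t → V × ℝ) ρ))).map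
      (fun p => (Fin.snoc p.1 p.2 : Fin (t + 1) → V × ℝ))

/-- A spectral bandit problem with `R`-sub-Gaussian noise on the node set `V`: a graph, a horizon,
a regularization parameter `reg > 0`, a distribution `prior` of the unknown coefficient vector
`α`, and the law `noise (α, v)` of the noise in a round in which the arm `v` is played. -/
structure SpectralBandit (V : Type*) [Fintype V] [MeasurableSpace V] (R : ℝ≥0) where
  graph : WeightedGraph V
  horizon : ℕ
  reg : ℝ
  reg_pos : 0 < reg
  prior : Measure (V → ℝ)
  isProbabilityMeasure_prior : IsProbabilityMeasure prior
  noise : Kernel ((V → ℝ) × V) ℝ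
  isMarkov_noise : IsMarkovKernel noise
  noise_mean : ∀ p, ∫ x, x ∂(noise p) = 0
  noise_subgaussian : ∀ p, HasSubgaussianMGF (fun x : ℝ => x) (R ^ 2) (noise p)

namespace SpectralBandit

variable {V : Type*} [Fintype V] [DecidableEq V] [MeasurableSpace V] [MeasurableSingletonClass V]
  {R : ℝ≥0} (P : SpectralBandit V R)

/-- The effective dimension of the problem. -/
def effectiveDimension : ℕ := P.graph.effectiveDimension P.reg P.horizon

/-- The law of the reward `r = f_α(v) + ε` of the arm `v`, for the coefficient vector `α`. -/
def rewardLaw (α : V → ℝ) : Kernel V ℝ :=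
  Kernel.ofFunOfCountable fun v => (P.noise (α, v)).map (fun ε => P.graph.signal α v + ε)

/-- The cumulative (pseudo-)regret `T max_v f_α(v) - ∑ t, f_α(a_t)` along a history of `T` rounds. -/
def regret (α : V → ℝ) (h : Fin P.horizon → V × ℝ) : ℝ :=
  P.horizon * (⨆ v, P.graph.signal α v) - ∑ t, P.graph.signal α (h t).1

/-- The expected regret of the algorithm `A`; the expectation is over `α`, over the noise and over
the internal randomization of `A`. The algorithm may depend on the problem, but not on `α`. -/
def expectedRegret (A : BanditAlgorithm V) : ℝ :=
  ∫ α, ∫ h, P.regret α h ∂(historyLaw A (P.rewardLaw α) P.horizon) ∂P.prior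

end SpectralBandit

end

/-! The block structure makes the problem a bandit with `d` arms. On one block, chosen uniformly at
random, the mean reward is a gap `Δ`, and elsewhere it is `0`. The regret is then `Δ` times the
number of rounds spent outside the good block.

The effective dimension is exact because the Laplacian has only the eigenvalues `0` (`d` times) and
`M`. Since `M ≥ T / d`, water-filling never reaches the level of the eigenvalue `M`, so the maximum
is `d` times the denominator (`blockGraph_effectiveDimension`).

For the regret, each bandit with a good block is compared with a null bandit in which all blocks
look alike. There the expected play counts of the blocks add up to `T`, so the average block gets
only `T / d` plays. A change of measure transfers this to the bandits with a good block, in two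
regimes.

If `d ≤ 2 T`, rewards are `±R` with bias `δ` of order `√(d / T)` on the good block. The relative
entropy from the null bandit is at most `δ ^ 2` per play of that block, hence bounded on average
over the blocks (`le_integral_sub_playCount`).

If `2 T ≤ d`, such a bias could exceed `1`, so noiseless rewards with gap `√(d / T)` are used: most
blocks are never visited, and a block that is not played cannot be detected
(`le_integral_sub_playCount_of_eq_off`). -/

/-! ### The spectrum of a disjoint union of complete graphs -/

/-- The indicator matrix of the relation of lying in the same block. -/
def blockMatrix (d M : ℕ) : Matrix (Fin d × Fin M) (Fin d × Fin M) ℝ :=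
  Matrix.of fun p q => if p.1 = q.1 then 1 else 0

theorem blockMatrix_mul_self (d M : ℕ) :
    blockMatrix d M * blockMatrix d M = (M : ℝ) • blockMatrix d M := by
  ext p q
  simp only [blockMatrix, Matrix.mul_apply, Matrix.of_apply, Matrix.smul_apply, smul_eq_mul,
    Fintype.sum_prod_type_right]
  by_cases h : p.1 = q.1 <;> simp [h]

theorem blockGraph_laplacian (d M : ℕ) :
    (blockGraph d M).laplacian = (M : ℝ) • 1 - blockMatrix d M := by
  have hdeg : ∀ p : Fin d × Fin M, ∑ q, (blockGraph d M).weight p q = M - 1 := by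
    intro p
    have h : ∀ q : Fin d × Fin M, (blockGraph d M).weight p q
        = (if p.1 = q.1 then 1 else 0) - (if p = q then 1 else 0) := by
      intro q
      by_cases hpq : p = q
      · simp [blockGraph, hpq]
      · simp [blockGraph, hpq]
    simp only [h, Finset.sum_sub_distrib, Fintype.sum_prod_type_right (fun q : Fin d × Fin M =>
      (if p.1 = q.1 then (1 : ℝ) else 0))]
    simp
  ext p q
  rw [WeightedGraph.laplacian, Matrix.sub_apply, Matrix.sub_apply, Matrix.diagonal_apply, hdeg]
  by_cases hpq : p = q
  · simp [blockGraph, blockMatrix, hpq]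
  · simp [blockGraph, blockMatrix, hpq]

theorem blockGraph_laplacian_mul_self (d M : ℕ) :
    (blockGraph d M).laplacian * (blockGraph d M).laplacian
      = (M : ℝ) • (blockGraph d M).laplacian := by
  simp only [blockGraph_laplacian, Matrix.sub_mul, Matrix.mul_sub, Matrix.smul_mul, Matrix.mul_smul,
    Matrix.one_mul, Matrix.mul_one, blockMatrix_mul_self, smul_sub]
  abel

/-- The Laplacian is annihilated by `X ^ 2 - M X`, so its eigenvalues are roots of this polynomial.
-/
theorem blockGraph_laplacianEigenvalue (d M : ℕ) (i : Fin d × Fin M) :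
    (blockGraph d M).laplacianEigenvalue i = 0 ∨ (blockGraph d M).laplacianEigenvalue i = M := by
  set hH := (blockGraph d M).laplacian_isHermitian
  set μ := (blockGraph d M).laplacianEigenvalue i with hμ
  have h1 := hH.mulVec_eigenvectorBasis i
  have h2 := congrArg (fun A => A.mulVec (⇑(hH.eigenvectorBasis i)))
    (blockGraph_laplacian_mul_self d M)
  simp only [← Matrix.mulVec_mulVec, Matrix.smul_mulVec, h1, Matrix.mulVec_smul] at h2
  have hne : (hH.eigenvectorBasis i) ≠ 0 := hH.eigenvectorBasis.orthonormal.ne_zero i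
  obtain ⟨v, hv⟩ : ∃ v, (hH.eigenvectorBasis i) v ≠ 0 := by
    by_contra! h
    exact hne (by ext v; simpa using h v)
  have h3 := congrFun h2 v
  change μ * (μ * _) = M * (μ * _) at h3
  have h4 : μ * (μ - M) = 0 := by
    apply mul_right_cancel₀ hv
    linear_combination h3
  rcases mul_eq_zero.1 h4 with h | h
  · exact Or.inl h
  · exact Or.inr (by linarith)

/-- With only two possible eigenvalues, the trace determines their multiplicities. -/
theorem blockGraph_numZeroEigenvalues (d M : ℕ) (hM : 1 ≤ M) :
    (blockGraph d M).numZeroEigenvalues = d := by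
  have hM' : (M : ℝ) ≠ 0 := by positivity
  have htr : (blockGraph d M).laplacian.trace = d * M * (M - 1) := by
    rw [blockGraph_laplacian]
    simp [Matrix.trace, blockMatrix]
    ring
  have hsum : ∑ i, (blockGraph d M).laplacianEigenvalue i = d * M * (M - 1) := by
    rw [← htr, (blockGraph d M).laplacian_isHermitian.trace_eq_sum_eigenvalues]
    rfl
  have hsum' : ∑ i, (blockGraph d M).laplacianEigenvalue i
      = ∑ i, ((M : ℝ) - M * if (blockGraph d M).laplacianEigenvalue i = 0 then 1 else 0) := by
    refine Finset.sum_congr rfl fun i _ => ?_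
    rcases blockGraph_laplacianEigenvalue d M i with h | h <;> simp [h, hM']
  rw [hsum, Finset.sum_sub_distrib, ← Finset.mul_sum, Finset.sum_boole] at hsum'
  simp only [Finset.sum_const, Finset.card_univ, Fintype.card_prod, Fintype.card_fin,
    nsmul_eq_mul, Nat.cast_mul] at hsum'
  have : ((blockGraph d M).numZeroEigenvalues : ℝ) = d := by
    apply mul_left_cancel₀ hM'
    unfold WeightedGraph.numZeroEigenvalues
    linear_combination hsum'
  exact_mod_cast this

/-- The tangent line bound for the concave function `t ↦ log (1 + t / a)` at `s`. -/
theorem log_one_add_div_le {a s t : ℝ} (ha : 0 < a) (hs : 0 ≤ s) (ht : 0 ≤ t) :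
    Real.log (1 + t / a) ≤ Real.log (1 + s / a) + (t - s) / (a + s) := by
  have has : 0 < a + s := by linarith
  have hat : 0 < a + t := by linarith
  have h1 : 1 + t / a = (1 + s / a) * ((a + t) / (a + s)) := by field_simp
  have h2 := Real.log_le_sub_one_of_pos (div_pos hat has)
  rw [h1, Real.log_mul (by positivity) (by positivity)]
  have h3 : (a + t) / (a + s) - 1 = (t - s) / (a + s) := by field_simp; ring
  linarith

/-- Water-filling: spreading `T` evenly over the `d` zero eigenvalues raises each to `lam + T / d ≤
lam + M`, so moving mass to the eigenvalue `M` gains nothing. Concavity turns this into a proof of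
optimality. -/
theorem blockGraph_effectiveDimension {T d M : ℕ} {lam : ℝ} (hT : 1 ≤ T) (hd : 1 ≤ d)
    (hlam : 0 < lam) (hM : (T : ℝ) / d ≤ M) (hM1 : 1 ≤ M) :
    (blockGraph d M).effectiveDimension lam T = d := by
  have hd0 : (0 : ℝ) < d := by exact_mod_cast hd
  have hT0 : (0 : ℝ) < T := by exact_mod_cast hT
  have hM0 : (M : ℝ) ≠ 0 := by positivity
  set e := (blockGraph d M).laplacianEigenvalue with he
  set s : ℝ := T / d with hs
  have hs0 : 0 < s := by positivity
  have hcard : ∑ i, (if e i = 0 then (1 : ℝ) else 0) = d := by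
    rw [Finset.sum_boole]
    exact_mod_cast blockGraph_numZeroEigenvalues d M hM1
  have hpos : ∀ i, 0 < lam + e i := by
    intro i
    rcases blockGraph_laplacianEigenvalue d M i with h | h <;> rw [he, h] <;> positivity
  have hmax : IsGreatest {x : ℝ | ∃ t : Fin d × Fin M → ℝ, (∀ i, 0 ≤ t i) ∧ ∑ i, t i = T ∧
        x = Real.log (∏ i, (1 + t i / (lam + e i)))} (d * Real.log (1 + s / lam)) := by
    constructor
    · refine ⟨fun i => s * if e i = 0 then 1 else 0, fun i => ?_, ?_, ?_⟩
      · positivity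
      · rw [← Finset.mul_sum, hcard, hs]
        field_simp
      · rw [Real.log_prod, ← hcard, Finset.sum_mul]
        · refine Finset.sum_congr rfl fun i _ => ?_
          by_cases h : e i = 0 <;> simp [h]
        · intro i _
          have := hpos i
          positivity
    · rintro x ⟨t, ht, hsum, rfl⟩
      rw [Real.log_prod]
      -- Tangent at `s` for the eigenvalue `0` and at `0` for the eigenvalue `M`. Both slopes are at
      -- most the common multiplier `(lam + s)⁻¹`, the second by `M ≥ T / d`, so only `∑ t i = T`
      -- enters the sum.
      · have hterm : ∀ i, Real.log (1 + t i / (lam + e i)) ≤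
            (Real.log (1 + s / lam) - s / (lam + s)) * (if e i = 0 then 1 else 0)
              + t i * (lam + s)⁻¹ := by
          intro i
          rcases blockGraph_laplacianEigenvalue d M i with h | h
          · have hei : e i = 0 := h
            have := log_one_add_div_le hlam hs0.le (ht i)
            simp only [hei, add_zero, if_true, mul_one]
            rw [sub_div] at this
            rw [← div_eq_mul_inv]
            linarith
          · have hei : e i = M := h
            have := log_one_add_div_le (hpos i) le_rfl (ht i)
            have h2 : t i / (lam + M) ≤ t i / (lam + s) := by
              apply div_le_div_of_nonneg_left (ht i) (by positivity)
              linarith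
            simp only [hei, hM0, if_false, mul_zero, zero_add, zero_div, add_zero, Real.log_one,
              sub_zero] at this ⊢
            rw [← div_eq_mul_inv]
            linarith
        refine (Finset.sum_le_sum fun i _ => hterm i).trans ?_
        rw [Finset.sum_add_distrib, ← Finset.mul_sum, ← Finset.sum_mul, hcard, hsum]
        apply le_of_eq
        have : (T : ℝ) = s * d := by rw [hs]; field_simp
        rw [this]
        field_simp
        ring
      · intro i _
        have := hpos i
        have := ht i
        positivity
  have hlog : 0 < Real.log (1 + s / lam) := Real.log_pos (by linarith [div_pos hs0 hlam])
  rw [WeightedGraph.effectiveDimension, ← he, hmax.csSup_eq, blockGraph_numZeroEigenvalues d M hM1,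
    ← div_div, ← hs, mul_div_cancel_right₀ _ hlog.ne', Nat.ceil_natCast]

/-- Expansion in an orthonormal basis; it allows mean rewards to be prescribed directly as functions
on the nodes. -/
theorem WeightedGraph.signal_surjective {V : Type*} [Fintype V] [DecidableEq V]
    (G : WeightedGraph V) : Function.Surjective G.signal := by
  intro f
  let b := G.laplacian_isHermitian.eigenvectorBasis
  refine ⟨fun k => b.repr (WithLp.toLp 2 f) k, ?_⟩
  ext v
  have h := congrArg (fun x : EuclideanSpace ℝ V => x v) (b.sum_repr (WithLp.toLp 2 f))
  simpa [WeightedGraph.signal, b] using h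

theorem WeightedGraph.measurable_signal {V : Type*} [Fintype V] [DecidableEq V]
    (G : WeightedGraph V) (v : V) : Measurable fun α => G.signal α v := by
  unfold WeightedGraph.signal
  fun_prop

theorem blockGraph_smoothness_eq_zero (d M : ℕ) (g : Fin d → ℝ) :
    (blockGraph d M).smoothness (fun v => g v.1) = 0 := by
  unfold WeightedGraph.smoothness
  simp only [mul_eq_zero]
  refine Or.inr (Finset.sum_eq_zero fun p _ => Finset.sum_eq_zero fun q _ => ?_)
  by_cases h : p.1 = q.1
  · simp [h]
  · simp [blockGraph, h]

/-! ### Change of measure for the history of a bandit algorithm -/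

section History

variable {V : Type*} [MeasurableSpace V] (A : BanditAlgorithm V) (ρ σ : Kernel V ℝ)

theorem measurable_history_snoc (t : ℕ) :
    Measurable fun p : (Fin t → V × ℝ) × (V × ℝ) => (Fin.snoc p.1 p.2 : Fin (t + 1) → V × ℝ) := by
  refine measurable_pi_lambda _ fun i => ?_
  induction i using Fin.lastCases with
  | last => simpa using measurable_snd
  | cast i =>
    simp only [Fin.snoc_castSucc]
    fun_prop

instance isProbabilityMeasure_historyLaw [IsMarkovKernel ρ] (t : ℕ) :
    IsProbabilityMeasure (historyLaw A ρ t) := by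
  induction t with
  | zero => rw [historyLaw]; infer_instance
  | succ t ih =>
    have := A.isMarkov t
    rw [historyLaw]
    exact Measure.isProbabilityMeasure_map (measurable_history_snoc t).aemeasurable

theorem lintegral_historyLaw_succ [IsMarkovKernel ρ] (t : ℕ) {F : (Fin (t + 1) → V × ℝ) → ℝ≥0∞}
    (hF : Measurable F) :
    ∫⁻ h, F h ∂(historyLaw A ρ (t + 1))
      = ∫⁻ h, ∫⁻ a, ∫⁻ r, F (Fin.snoc h (a, r)) ∂(ρ a) ∂(A.policy t h) ∂(historyLaw A ρ t) := by
  have := A.isMarkov t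
  have hm := measurable_history_snoc (V := V) t
  rw [historyLaw, lintegral_map hF hm,
    Measure.lintegral_compProd (f := fun p => F (Fin.snoc p.1 p.2)) (hF.comp hm)]
  refine lintegral_congr fun h => ?_
  rw [Kernel.lintegral_compProd]
  · simp [Kernel.prodMkLeft_apply]
  · exact (hF.comp hm).comp measurable_prodMk_left

theorem integral_historyLaw_succ [IsMarkovKernel ρ] (t : ℕ) {F : (Fin (t + 1) → V × ℝ) → ℝ}
    (hF : Measurable F) {C : ℝ} (hC : ∀ h, |F h| ≤ C) :
    ∫ h, F h ∂(historyLaw A ρ (t + 1))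
      = ∫ h, ∫ a, ∫ r, F (Fin.snoc h (a, r)) ∂(ρ a) ∂(A.policy t h) ∂(historyLaw A ρ t) := by
  have := A.isMarkov t
  have hm := measurable_history_snoc (V := V) t
  rw [historyLaw, integral_map hm.aemeasurable hF.aestronglyMeasurable, Measure.integral_compProd]
  · refine integral_congr_ae (ae_of_all _ fun h => ?_)
    change ∫ p, F (Fin.snoc h p) ∂_ = _
    rw [ProbabilityTheory.integral_compProd]
    · simp [Kernel.prodMkLeft_apply]
    · exact Integrable.of_bound ((hF.comp hm).comp measurable_prodMk_left).aestronglyMeasurable C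
        (ae_of_all _ fun _ => hC _)
  · exact Integrable.of_bound (hF.comp hm).aestronglyMeasurable C (ae_of_all _ fun _ => hC _)

/-- If the reward laws `σ` dominate the reward laws `ρ` with density `ℓ`, then the history laws
dominate each other with the product density. -/
theorem lintegral_prod_mul_le_historyLaw [IsMarkovKernel ρ] [IsMarkovKernel σ]
    {ℓ : V × ℝ → ℝ≥0∞} (hℓ : Measurable ℓ)
    (h : ∀ a, ∀ g : ℝ → ℝ≥0∞, Measurable g → ∫⁻ r, ℓ (a, r) * g r ∂(ρ a) ≤ ∫⁻ r, g r ∂(σ a))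
    (t : ℕ) {F : (Fin t → V × ℝ) → ℝ≥0∞} (hF : Measurable F) :
    ∫⁻ x, (∏ s, ℓ (x s)) * F x ∂(historyLaw A ρ t) ≤ ∫⁻ x, F x ∂(historyLaw A σ t) := by
  induction t with
  | zero => simp [historyLaw]
  | succ t ih =>
    have := A.isMarkov t
    have hm := measurable_history_snoc (V := V) t
    have hprod : ∀ n, Measurable fun x : Fin n → V × ℝ => ∏ s, ℓ (x s) := fun n =>
      Finset.measurable_fun_prod _ fun s _ => hℓ.comp (measurable_pi_apply s)
    have hFs : Measurable fun p : ((Fin t → V × ℝ) × V) × ℝ =>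
        F (Fin.snoc p.1.1 (p.1.2, p.2)) :=
      (hF.comp hm).comp (by fun_prop :
        Measurable fun p : ((Fin t → V × ℝ) × V) × ℝ => (p.1.1, (p.1.2, p.2)))
    have h1 : Measurable fun p : (Fin t → V × ℝ) × V =>
        ∫⁻ r, F (Fin.snoc p.1 (p.2, r)) ∂(σ p.2) :=
      Measurable.lintegral_kernel_prod_right' (κ := Kernel.prodMkLeft (Fin t → V × ℝ) σ) hFs
    rw [lintegral_historyLaw_succ A ρ t (F := fun x => (∏ s, ℓ (x s)) * F x) ((hprod _).mul hF),
      lintegral_historyLaw_succ A σ t hF]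
    refine le_trans ?_ (ih ?_)
    · refine lintegral_mono fun x => ?_
      simp only
      have h2 : Measurable fun a => ∫⁻ r, F (Fin.snoc x (a, r)) ∂(σ a) :=
        h1.comp (measurable_prodMk_left (x := x))
      rw [← lintegral_const_mul _ h2]
      refine lintegral_mono fun a => ?_
      have hg : Measurable fun r => F (Fin.snoc x (a, r)) :=
        hFs.comp (measurable_prodMk_left (x := (x, a)))
      calc _ = ∫⁻ r, (∏ s, ℓ (x s)) * (ℓ (a, r) * F (Fin.snoc x (a, r))) ∂(ρ a) := by
            refine lintegral_congr fun r => ?_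
            rw [Fin.prod_univ_castSucc]
            simp [mul_assoc]
        _ = (∏ s, ℓ (x s)) * ∫⁻ r, ℓ (a, r) * F (Fin.snoc x (a, r)) ∂(ρ a) :=
            lintegral_const_mul _ ((hℓ.comp measurable_prodMk_left).mul hg)
        _ ≤ _ := mul_le_mul_right (h a _ hg) _
    · exact Measurable.lintegral_kernel_prod_right' (κ := A.policy t) h1

/-- Real-valued form of the preceding bound. The upper bound on `X` keeps the right-hand side
finite, as monotonicity of `toReal` requires. -/
theorem integral_prod_mul_le_historyLaw [IsMarkovKernel ρ] [IsMarkovKernel σ]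
    {ℓ : V × ℝ → ℝ} (hℓ : Measurable ℓ) (hℓ0 : ∀ p, 0 ≤ ℓ p)
    (h : ∀ a, ∀ g : ℝ → ℝ≥0∞, Measurable g →
      ∫⁻ r, ENNReal.ofReal (ℓ (a, r)) * g r ∂(ρ a) ≤ ∫⁻ r, g r ∂(σ a))
    (t : ℕ) {X : (Fin t → V × ℝ) → ℝ} (hX : Measurable X) (hX0 : ∀ x, 0 ≤ X x) {C : ℝ}
    (hXC : ∀ x, X x ≤ C) :
    ∫ x, (∏ s, ℓ (x s)) * X x ∂(historyLaw A ρ t) ≤ ∫ x, X x ∂(historyLaw A σ t) := by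
  have hprod : Measurable fun x : Fin t → V × ℝ => ∏ s, ℓ (x s) :=
    Finset.measurable_fun_prod _ fun s _ => hℓ.comp (measurable_pi_apply s)
  have hX' : Integrable X (historyLaw A σ t) :=
    Integrable.of_bound hX.aestronglyMeasurable C
      (ae_of_all _ fun x => by rw [Real.norm_of_nonneg (hX0 x)]; exact hXC x)
  have hp0 : ∀ x : Fin t → V × ℝ, 0 ≤ ∏ s, ℓ (x s) := fun x => Finset.prod_nonneg fun s _ => hℓ0 _
  rw [integral_eq_lintegral_of_nonneg_ae (ae_of_all _ fun x => mul_nonneg (hp0 x) (hX0 x))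
      (hprod.mul hX).aestronglyMeasurable,
    integral_eq_lintegral_of_nonneg_ae (ae_of_all _ hX0) hX.aestronglyMeasurable]
  refine ENNReal.toReal_mono ?_ ?_
  · rw [← ofReal_integral_eq_lintegral_ofReal hX' (ae_of_all _ hX0)]
    exact ENNReal.ofReal_ne_top
  · refine le_trans (le_of_eq ?_) (lintegral_prod_mul_le_historyLaw A ρ σ
      (ENNReal.measurable_ofReal.comp hℓ) h t (ENNReal.measurable_ofReal.comp hX))
    refine lintegral_congr fun x => ?_
    simp only [Function.comp]
    rw [ENNReal.ofReal_mul (hp0 x), ENNReal.ofReal_prod_of_nonneg fun s _ => hℓ0 _]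

theorem integrable_sum_historyLaw [IsMarkovKernel ρ] {ψ : V × ℝ → ℝ} (hψ : Measurable ψ) {C : ℝ}
    (hC : ∀ p, |ψ p| ≤ C) (t : ℕ) :
    Integrable (fun x : Fin t → V × ℝ => ∑ s, ψ (x s)) (historyLaw A ρ t) :=
  integrable_finsetSum _ fun s _ =>
    Integrable.of_bound (hψ.comp (measurable_pi_apply s)).aestronglyMeasurable C
      (ae_of_all _ fun _ => hC _)

/-- A function of arm and reward that is centred under each reward law has cumulative mean zero. -/
theorem integral_sum_historyLaw_eq_zero [IsMarkovKernel ρ] {ψ : V × ℝ → ℝ} (hψ : Measurable ψ)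
    {C : ℝ} (hC : ∀ p, |ψ p| ≤ C) (h : ∀ a, ∫ r, ψ (a, r) ∂(ρ a) = 0) (t : ℕ) :
    ∫ x, ∑ s, ψ (x s) ∂(historyLaw A ρ t) = 0 := by
  induction t with
  | zero => simp
  | succ t ih =>
    have := A.isMarkov t
    rw [integral_historyLaw_succ A ρ t (C := (t + 1 : ℕ) * C), ← ih]
    · refine integral_congr_ae (ae_of_all _ fun x => ?_)
      have hr : ∀ a, ∫ r, ∑ s : Fin (t + 1), ψ ((Fin.snoc x (a, r) : Fin (t + 1) → V × ℝ) s) ∂(ρ a)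
          = ∑ s, ψ (x s) := by
        intro a
        simp only [Fin.sum_univ_castSucc, Fin.snoc_castSucc, Fin.snoc_last]
        rw [integral_add (integrable_const _), h, integral_const]
        · simp
        · exact Integrable.of_bound (hψ.comp measurable_prodMk_left).aestronglyMeasurable C
            (ae_of_all _ fun _ => hC _)
      simp [hr]
    · exact Finset.measurable_fun_sum _ fun s _ => hψ.comp (measurable_pi_apply s)
    · intro x
      refine (Finset.abs_sum_le_sum_abs _ _).trans ?_
      refine (Finset.sum_le_sum fun s _ => hC (x s)).trans ?_
      simp

end History

/-! ### ### Play counts under a change of measure -/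

/-- The number of rounds in which an arm of `B` has been played. -/
noncomputable def playCount {V : Type*} (B : Set V) {t : ℕ} (x : Fin t → V × ℝ) : ℝ :=
  ∑ s, B.indicator 1 (x s).1

section PlayCount

variable {V : Type*} {B : Set V}

theorem playCount_nonneg {t : ℕ} (x : Fin t → V × ℝ) : 0 ≤ playCount B x :=
  Finset.sum_nonneg fun _ _ => Set.indicator_nonneg (fun _ _ => zero_le_one) _

theorem playCount_le {t : ℕ} (x : Fin t → V × ℝ) : playCount B x ≤ t := by
  have h : ∀ a, B.indicator (1 : V → ℝ) a ≤ 1 := fun a =>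
    Set.indicator_le_self' (f := (1 : V → ℝ)) (fun _ _ => zero_le_one) a
  simpa [playCount] using Finset.sum_le_sum fun s (_ : s ∈ Finset.univ) => h (x s).1

variable [MeasurableSpace V]

theorem measurable_playCount (hB : MeasurableSet B) (t : ℕ) :
    Measurable fun x : Fin t → V × ℝ => playCount B x :=
  Finset.measurable_fun_sum _ fun s _ =>
    (measurable_one.indicator hB).comp (measurable_fst.comp (measurable_pi_apply s))

theorem integrable_playCount (A : BanditAlgorithm V) (ρ : Kernel V ℝ) [IsMarkovKernel ρ]
    (hB : MeasurableSet B) (t : ℕ) : Integrable (playCount B) (historyLaw A ρ t) :=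
  Integrable.of_bound (measurable_playCount hB t).aestronglyMeasurable t
    (ae_of_all _ fun x => by rw [Real.norm_of_nonneg (playCount_nonneg x)]; exact playCount_le x)

/-- If the reward laws differ only on `B`, then the number of rounds spent outside of `B` is at
least `t` on the event that `B` is never played, whose probability is the same under both laws. -/
theorem le_integral_sub_playCount_of_eq_off (A : BanditAlgorithm V) (ρ σ : Kernel V ℝ)
    [IsMarkovKernel ρ] [IsMarkovKernel σ] (hB : MeasurableSet B) (h : ∀ a ∉ B, ρ a = σ a) (t : ℕ) :
    t - t * ∫ x, playCount B x ∂(historyLaw A ρ t)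
      ≤ ∫ x, (t - playCount B x) ∂(historyLaw A σ t) := by
  -- With density zero on `B` the domination is trivial there, so the two reward laws may even be
  -- mutually singular on `B`. The product density is the indicator of the histories that avoid `B`.
  let ℓ : V × ℝ → ℝ := fun p => Bᶜ.indicator 1 p.1
  have hℓ : Measurable ℓ := (measurable_one.indicator hB.compl).comp measurable_fst
  have hℓ0 : ∀ p, 0 ≤ ℓ p := fun p => Set.indicator_nonneg (fun _ _ => zero_le_one) _
  have hℓ1 : ∀ p, ℓ p ≤ 1 := fun p =>
    Set.indicator_le_self' (f := (1 : V → ℝ)) (fun _ _ => zero_le_one) _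
  have hprod : Measurable fun x : Fin t → V × ℝ => ∏ s, ℓ (x s) :=
    Finset.measurable_fun_prod _ fun s _ => hℓ.comp (measurable_pi_apply s)
  have hX : Measurable fun x : Fin t → V × ℝ => (t : ℝ) - playCount B x :=
    measurable_const.sub (measurable_playCount hB t)
  have hX0 : ∀ x : Fin t → V × ℝ, 0 ≤ (t : ℝ) - playCount B x := fun x =>
    sub_nonneg.2 (playCount_le x)
  have hXC : ∀ x : Fin t → V × ℝ, (t : ℝ) - playCount B x ≤ t := fun x =>
    sub_le_self _ (playCount_nonneg x)
  have hp0 : ∀ x : Fin t → V × ℝ, 0 ≤ ∏ s, ℓ (x s) := fun x => Finset.prod_nonneg fun s _ => hℓ0 _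
  have hp1 : ∀ x : Fin t → V × ℝ, ∏ s, ℓ (x s) ≤ 1 := fun x =>
    Finset.prod_le_one (fun s _ => hℓ0 _) fun s _ => hℓ1 _
  refine le_trans ?_ (integral_prod_mul_le_historyLaw A ρ σ hℓ hℓ0 ?_ t hX hX0 hXC)
  · have hI := integrable_playCount A ρ hB t
    have : t - t * ∫ x, playCount B x ∂(historyLaw A ρ t)
        = ∫ x, (t - t * playCount B x) ∂(historyLaw A ρ t) := by
      rw [integral_sub (integrable_const _) (hI.const_mul _), integral_const_mul]
      simp
    rw [this]
    refine integral_mono ((integrable_const _).sub (hI.const_mul _)) ?_ fun x => ?_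
    · refine Integrable.of_bound (hprod.mul hX).aestronglyMeasurable t (ae_of_all _ fun x => ?_)
      rw [Real.norm_of_nonneg (mul_nonneg (hp0 x) (hX0 x))]
      exact (mul_le_of_le_one_left (hX0 x) (hp1 x)).trans (hXC x)
    · simp only
      by_cases hx : ∃ s, (x s).1 ∈ B
      · obtain ⟨s, hs⟩ := hx
        have h1 : 1 ≤ playCount B x := by
          have := Finset.single_le_sum (f := fun s => B.indicator (1 : V → ℝ) (x s).1)
            (fun _ _ => Set.indicator_nonneg (fun _ _ => zero_le_one) _) (Finset.mem_univ s)
          simpa [hs, playCount] using this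
        have h2 : (t : ℝ) - t * playCount B x ≤ 0 := by
          nlinarith [(Nat.cast_nonneg t : (0 : ℝ) ≤ t)]
        exact h2.trans (mul_nonneg (hp0 x) (hX0 x))
      · push Not at hx
        have h1 : playCount B x = 0 := Finset.sum_eq_zero fun s _ => by simp [hx s]
        have h2 : ∏ s, ℓ (x s) = 1 := Finset.prod_eq_one fun s _ => by simp [ℓ, hx s]
        rw [h1, h2]
        simp
  · intro a g hg
    by_cases ha : a ∈ B
    · simp [ℓ, ha]
    · simp [ℓ, ha, h a ha]

/-- A pointwise substitute for Pinsker's inequality: for a likelihood ratio `L` with mean at most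
`1`, the last term integrates to at most the relative entropy over `η`. With `y = √L`, the bound
`log y ≤ y - 1` gives `L - 1 - log L ≥ (1 - y) ^ 2`, and the rest is completing a square. -/
theorem one_sub_le_add_div {L η : ℝ} (hL : 0 < L) (hη : 0 < η) :
    1 - L ≤ η + (L - 1 - Real.log L) / η := by
  set y := √L with hy
  have hy0 : 0 < y := Real.sqrt_pos.2 hL
  have hyL : L = y ^ 2 := (Real.sq_sqrt hL.le).symm
  have hlog : Real.log L = 2 * Real.log y := by rw [hyL, Real.log_pow]; norm_num
  have h1 := Real.log_le_sub_one_of_pos hy0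
  have h2 : (1 - y) ^ 2 / η ≤ (L - 1 - Real.log L) / η := by
    gcongr
    rw [hlog, hyL]
    nlinarith
  have h3 : 1 - L ≤ η + (1 - y) ^ 2 / η := by
    rw [← sub_nonneg]
    have h4 : η + (1 - y) ^ 2 / η - (1 - L) = ((η - (1 - y)) ^ 2 + η * (1 - y) ^ 2) / η := by
      rw [hyL]
      field_simp
      ring
    rw [h4]
    positivity
  linarith

/-- A lower bound for the number of rounds spent outside of `B` under the reward laws `σ`, in terms
of the reward laws `ρ`, whose relative entropy with respect to `σ` is `κ` on `B` and `0` off `B`. -/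
theorem le_integral_sub_playCount (A : BanditAlgorithm V) (ρ σ : Kernel V ℝ)
    [IsMarkovKernel ρ] [IsMarkovKernel σ] (hB : MeasurableSet B) {ℓ : V × ℝ → ℝ}
    (hℓ : Measurable ℓ) {b C : ℝ} (hb : 0 < b) (hbℓ : ∀ p, b ≤ ℓ p) (hℓC : ∀ p, ℓ p ≤ C)
    (h : ∀ a, ∀ g : ℝ → ℝ≥0∞, Measurable g →
      ∫⁻ r, ENNReal.ofReal (ℓ (a, r)) * g r ∂(ρ a) ≤ ∫⁻ r, g r ∂(σ a))
    {κ : ℝ} (hκ : ∀ a, ∫ r, -Real.log (ℓ (a, r)) ∂(ρ a) = κ * B.indicator 1 a)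
    {η : ℝ} (hη : 0 < η) (t : ℕ) :
    t - ∫ x, playCount B x ∂(historyLaw A ρ t) - t * η
        - t / η * κ * ∫ x, playCount B x ∂(historyLaw A ρ t)
      ≤ ∫ x, (t - playCount B x) ∂(historyLaw A σ t) := by
  set P := historyLaw A ρ t with hP
  have hℓ0 : ∀ p, 0 < ℓ p := fun p => hb.trans_le (hbℓ p)
  have hprod : Measurable fun x : Fin t → V × ℝ => ∏ s, ℓ (x s) :=
    Finset.measurable_fun_prod _ fun s _ => hℓ.comp (measurable_pi_apply s)
  have hX : Measurable fun x : Fin t → V × ℝ => (t : ℝ) - playCount B x :=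
    measurable_const.sub (measurable_playCount hB t)
  have hX0 : ∀ x : Fin t → V × ℝ, 0 ≤ (t : ℝ) - playCount B x := fun x =>
    sub_nonneg.2 (playCount_le x)
  have hXC : ∀ x : Fin t → V × ℝ, (t : ℝ) - playCount B x ≤ t := fun x =>
    sub_le_self _ (playCount_nonneg x)
  have hp0 : ∀ x : Fin t → V × ℝ, 0 < ∏ s, ℓ (x s) := fun x => Finset.prod_pos fun s _ => hℓ0 _
  have hpC : ∀ x : Fin t → V × ℝ, ∏ s, ℓ (x s) ≤ C ^ t := fun x => by
    simpa using Finset.prod_le_prod (fun s (_ : s ∈ Finset.univ) => (hℓ0 (x s)).le)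
      fun s _ => hℓC (x s)
  have hlogm : Measurable fun p => -Real.log (ℓ p) := (Real.measurable_log.comp hℓ).neg
  have hlogb : ∀ p, |-Real.log (ℓ p)| ≤ max (Real.log C) (-Real.log b) := by
    intro p
    rw [abs_neg, abs_le]
    have h1 := Real.log_le_log hb (hbℓ p)
    have h2 := Real.log_le_log (hℓ0 p) (hℓC p)
    constructor
    · linarith [le_max_right (Real.log C) (-Real.log b)]
    · exact h2.trans (le_max_left _ _)
  have hL1 : ∫ x, ∏ s, ℓ (x s) ∂P ≤ 1 := by
    have := integral_prod_mul_le_historyLaw A ρ σ hℓ (fun p => (hℓ0 p).le) h t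
      (X := fun _ => 1) measurable_const (fun _ => zero_le_one) (fun _ => le_rfl)
    simpa using this
  have hLint : Integrable (fun x : Fin t → V × ℝ => ∏ s, ℓ (x s)) P :=
    Integrable.of_bound hprod.aestronglyMeasurable (C ^ t)
      (ae_of_all _ fun x => by rw [Real.norm_of_nonneg (hp0 x).le]; exact hpC x)
  have hSint : Integrable (fun x : Fin t → V × ℝ => ∑ s, -Real.log (ℓ (x s))) P :=
    integrable_sum_historyLaw A ρ hlogm hlogb t
  have hN : Integrable (playCount B) P := integrable_playCount A ρ hB t
  have hS : ∫ x, ∑ s, -Real.log (ℓ (x s)) ∂P = κ * ∫ x, playCount B x ∂P := by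
    have hind : Measurable fun p : V × ℝ => κ * B.indicator (1 : V → ℝ) p.1 :=
      ((measurable_one.indicator hB).comp measurable_fst).const_mul κ
    -- Chain rule for relative entropy: each play of `B` contributes `κ` in expectation, so the
    -- log-likelihood minus `κ` times the play count is centred.
    have h0 := integral_sum_historyLaw_eq_zero A ρ
      (ψ := fun p => -Real.log (ℓ p) - κ * B.indicator 1 p.1) (hlogm.sub hind)
      (C := max (Real.log C) (-Real.log b) + |κ|) (fun p => ?_) (fun a => ?_) t
    · simp only [Finset.sum_sub_distrib, ← Finset.mul_sum] at h0
      change ∫ x, (∑ s, -Real.log (ℓ (x s)) - κ * playCount B x) ∂P = 0 at h0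
      rw [integral_sub hSint (hN.const_mul κ), sub_eq_zero] at h0
      rw [h0, integral_const_mul]
    · refine (abs_sub _ _).trans (add_le_add (hlogb p) ?_)
      by_cases hp : p.1 ∈ B <;> simp [hp]
    · rw [integral_sub, hκ]
      · simp
      · exact Integrable.of_bound (hlogm.comp measurable_prodMk_left).aestronglyMeasurable _
          (ae_of_all _ fun _ => hlogb _)
      · exact integrable_const (κ * B.indicator 1 a)
  have hI1 : Integrable (fun x => (t : ℝ) - playCount B x) P := (integrable_const _).sub hN
  have hI2 : Integrable (fun x : Fin t → V × ℝ =>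
      t / η * (∏ s, ℓ (x s) - 1 + ∑ s, -Real.log (ℓ (x s)))) P :=
    ((hLint.sub (integrable_const _)).add hSint).const_mul _
  -- Multiply `one_sub_le_add_div` by `t - playCount B x`, which lies in `[0, t]`; its right-hand
  -- side is nonnegative, so the factor there may be replaced by `t`.
  have hlow : ∫ x, ((t - playCount B x) - t * η
        - t / η * (∏ s, ℓ (x s) - 1 + ∑ s, -Real.log (ℓ (x s)))) ∂P
      ≤ ∫ x, (∏ s, ℓ (x s)) * (t - playCount B x) ∂P := by
    refine integral_mono ((hI1.sub (integrable_const _)).sub hI2) ?_ fun x => ?_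
    · refine Integrable.of_bound (hprod.mul hX).aestronglyMeasurable (C ^ t * t)
        (ae_of_all _ fun x => ?_)
      rw [Real.norm_of_nonneg (mul_nonneg (hp0 x).le (hX0 x))]
      exact mul_le_mul (hpC x) (hXC x) (hX0 x) ((hp0 x).le.trans (hpC x))
    · simp only
      have h1 := one_sub_le_add_div (hp0 x) hη
      have h2 : ∑ s, -Real.log (ℓ (x s)) = -Real.log (∏ s, ℓ (x s)) := by
        rw [Real.log_prod fun s _ => (hℓ0 _).ne', Finset.sum_neg_distrib]
      have h3 : 0 ≤ η + (∏ s, ℓ (x s) - 1 - Real.log (∏ s, ℓ (x s))) / η := by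
        have := Real.log_le_sub_one_of_pos (hp0 x)
        have : 0 ≤ ∏ s, ℓ (x s) - 1 - Real.log (∏ s, ℓ (x s)) := by linarith
        positivity
      have h4 := mul_le_mul_of_nonneg_left h1 (hX0 x)
      have h5 := mul_le_mul_of_nonneg_right (hXC x) h3
      have h6 : (t : ℝ) * (η + (∏ s, ℓ (x s) - 1 - Real.log (∏ s, ℓ (x s))) / η)
          = t * η + t / η * (∏ s, ℓ (x s) - 1 + -Real.log (∏ s, ℓ (x s))) := by ring
      rw [h2]
      linarith
  refine le_trans ?_ (hlow.trans
    (integral_prod_mul_le_historyLaw A ρ σ hℓ (fun p => (hℓ0 p).le) h t hX hX0 hXC))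
  have hI3 : Integrable (fun x => (t : ℝ) - playCount B x - t * η) P :=
    hI1.sub (integrable_const _)
  have hI4 : Integrable (fun x : Fin t → V × ℝ => ∏ s, ℓ (x s) - 1) P :=
    hLint.sub (integrable_const _)
  rw [integral_sub hI3 hI2, integral_sub hI1 (integrable_const _),
    integral_sub (integrable_const _) hN, integral_const_mul (t / η : ℝ), integral_add hI4 hSint,
    integral_sub hLint (integrable_const _), hS]
  simp only [integral_const, probReal_univ, smul_eq_mul, one_mul]
  have : t / η * (∫ x, ∏ s, ℓ (x s) ∂P - 1 + κ * ∫ x, playCount B x ∂P)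
      ≤ t / η * (κ * ∫ x, playCount B x ∂P) := by
    gcongr
    linarith
  linarith

end PlayCount

/-! ### Block bandits with one good block -/

/-- The reward laws of a bandit in which the arms of block `k` have reward law `ν'`, and all other
arms have reward law `ν`. -/
noncomputable def blockReward {d M : ℕ} (ν ν' : Measure ℝ) (k : Fin d) :
    Kernel (Fin d × Fin M) ℝ :=
  Kernel.ofFunOfCountable fun v => if v.1 = k then ν' else ν

instance isMarkovKernel_blockReward {d M : ℕ} (ν ν' : Measure ℝ) [IsProbabilityMeasure ν]
    [IsProbabilityMeasure ν'] (k : Fin d) :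
    IsMarkovKernel (blockReward ν ν' k : Kernel (Fin d × Fin M) ℝ) := by
  refine ⟨fun v => ?_⟩
  change IsProbabilityMeasure (if v.1 = k then ν' else ν)
  split_ifs <;> infer_instance

/-- The set of arms of block `k`. -/
def blockArms {d : ℕ} (M : ℕ) (k : Fin d) : Set (Fin d × Fin M) := {v | v.1 = k}

theorem sum_playCount_blockArms {d M t : ℕ} (x : Fin t → (Fin d × Fin M) × ℝ) :
    ∑ k, playCount (blockArms M k) x = t := by
  unfold playCount
  rw [Finset.sum_comm]
  simp [blockArms, Set.indicator_apply]

/-- For a gap `Δ` and centred noise laws `ν`, `ν'`, there is a spectral bandit whose mean reward is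
`Δ` on a uniformly random block and `0` elsewhere, with noise `ν'` on this block and `ν` off it. -/
theorem exists_spectralBandit_blockGraph {R : ℝ≥0} {T d M : ℕ} {lam Δ : ℝ} (hT : 1 ≤ T)
    (hd : 1 ≤ d) (hlam : 0 < lam) (hM : (T : ℝ) / d ≤ M) (hΔ : 0 < Δ) (ν ν' : Measure ℝ)
    [IsProbabilityMeasure ν] [IsProbabilityMeasure ν'] (hν : ∫ x, x ∂ν = 0) (hν' : ∫ x, x ∂ν' = 0)
    (hνs : HasSubgaussianMGF (fun x : ℝ => x) (R ^ 2) ν)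
    (hνs' : HasSubgaussianMGF (fun x : ℝ => x) (R ^ 2) ν') :
    ∃ P : SpectralBandit (Fin d × Fin M) R,
      P.graph = blockGraph d M ∧ P.horizon = T ∧ P.reg = lam ∧ P.effectiveDimension = d ∧
      (∀ᵐ α ∂P.prior, P.graph.smoothness (P.graph.signal α) = 0 ∧
          ∀ v, 0 ≤ P.graph.signal α v ∧ P.graph.signal α v ≤ Δ) ∧
      ∀ A : BanditAlgorithm (Fin d × Fin M), P.expectedRegret A = (d : ℝ)⁻¹ * ∑ k,
        Δ * ∫ x, (T - playCount (blockArms M k) x)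
          ∂(historyLaw A (blockReward ν (ν'.map (Δ + ·)) k) T) := by
  classical
  have hd0 : (0 : ℝ) < d := by exact_mod_cast hd
  have hT0 : (0 : ℝ) < T := by exact_mod_cast hT
  have hM1 : 1 ≤ M := by
    have : (0 : ℝ) < M := (div_pos hT0 hd0).trans_le hM
    exact_mod_cast this
  have : Nonempty (Fin M) := ⟨⟨0, hM1⟩⟩
  choose α hα using fun k : Fin d =>
    (blockGraph d M).signal_surjective fun v => if v.1 = k then Δ else 0
  have hS : MeasurableSet {p : (Fin d × Fin M → ℝ) × (Fin d × Fin M) |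
      (blockGraph d M).signal p.1 p.2 = Δ} :=
    measurableSet_eq_fun (measurable_from_prod_countable_left
      fun v => (blockGraph d M).measurable_signal v) measurable_const
  -- The noise law must be defined for every `α`, not only those charged by the prior; testing
  -- whether the mean equals `Δ` singles out the good block, because `Δ ≠ 0`.
  let noise : Kernel ((Fin d × Fin M → ℝ) × (Fin d × Fin M)) ℝ :=
    Kernel.piecewise hS (Kernel.const _ ν') (Kernel.const _ ν)
  have hnoise : ∀ p, noise p = ν' ∨ noise p = ν := by
    intro p
    simp only [noise, Kernel.piecewise_apply, Kernel.const_apply]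
    split_ifs <;> simp
  have hd1 : (d : ℝ≥0∞) ≠ 0 := by simpa using Nat.one_le_iff_ne_zero.1 hd
  let P : SpectralBandit (Fin d × Fin M) R :=
    { graph := blockGraph d M
      horizon := T
      reg := lam
      reg_pos := hlam
      prior := (d : ℝ≥0∞)⁻¹ • ∑ k, Measure.dirac (α k)
      isProbabilityMeasure_prior := ⟨by
        simp [Measure.smul_apply, Measure.finsetSum_apply,
          ENNReal.inv_mul_cancel hd1 (ENNReal.natCast_ne_top d)]⟩
      noise := noise
      isMarkov_noise := ⟨fun p => by
        rcases hnoise p with h | h <;> rw [h] <;> infer_instance⟩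
      noise_mean := fun p => by rcases hnoise p with h | h <;> rw [h] <;> assumption
      noise_subgaussian := fun p => by rcases hnoise p with h | h <;> rw [h] <;> assumption }
  refine ⟨P, rfl, rfl, rfl, blockGraph_effectiveDimension hT hd hlam hM hM1, ?_, fun A => ?_⟩
  · refine Measure.ae_smul_measure ?_ _
    rw [← Measure.sum_fintype, Measure.ae_sum_iff]
    intro k
    rw [ae_dirac_eq]
    change (blockGraph d M).smoothness ((blockGraph d M).signal (α k)) = 0 ∧
      ∀ v, 0 ≤ (blockGraph d M).signal (α k) v ∧ (blockGraph d M).signal (α k) v ≤ Δ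
    rw [hα]
    refine ⟨blockGraph_smoothness_eq_zero d M fun j => if j = k then Δ else 0, fun v => ?_⟩
    dsimp only
    split_ifs <;> simp [hΔ.le]
  · have hrew : ∀ k, P.rewardLaw (α k) = blockReward ν (ν'.map (Δ + ·)) k := by
      intro k
      ext1 v
      change (noise (α k, v)).map (fun ε => (blockGraph d M).signal (α k) v + ε)
        = if v.1 = k then ν'.map (Δ + ·) else ν
      simp only [hα, noise, Kernel.piecewise_apply, Kernel.const_apply, Set.mem_ofPred_eq]
      by_cases hv : v.1 = k
      · simp [hv]
      · simp [hv, hΔ.ne]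
    have hsup : ∀ k, ⨆ v, (blockGraph d M).signal (α k) v = Δ := by
      intro k
      simp only [hα]
      refine le_antisymm (Real.iSup_le (fun v => ?_) hΔ.le) ?_
      · split_ifs <;> simp [hΔ.le]
      · refine le_ciSup_of_le (Set.finite_range _).bddAbove (k, Classical.arbitrary _) ?_
        simp
    have hreg : ∀ k (x : Fin T → (Fin d × Fin M) × ℝ),
        P.regret (α k) x = Δ * (T - playCount (blockArms M k) x) := by
      intro k x
      change T * (⨆ v, (blockGraph d M).signal (α k) v)
        - ∑ t, (blockGraph d M).signal (α k) (x t).1 = _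
      rw [hsup]
      have : ∑ t, (blockGraph d M).signal (α k) (x t).1 = Δ * playCount (blockArms M k) x := by
        rw [playCount, Finset.mul_sum]
        refine Finset.sum_congr rfl fun t _ => ?_
        simp [hα, blockArms, Set.indicator_apply]
      rw [this]
      ring
    have hk : ∀ k, ∫ x, P.regret (α k) x ∂(historyLaw A (P.rewardLaw (α k)) T)
        = Δ * ∫ x, (T - playCount (blockArms M k) x)
          ∂(historyLaw A (blockReward ν (ν'.map (Δ + ·)) k) T) := by
      intro k
      rw [hrew, ← integral_const_mul]
      exact integral_congr_ae (ae_of_all _ (hreg k))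
    change ∫ β, ∫ x, P.regret β x ∂(historyLaw A (P.rewardLaw β) T)
      ∂((d : ℝ≥0∞)⁻¹ • ∑ k, Measure.dirac (α k)) = _
    rw [integral_smul_measure, integral_finsetSum_measure]
    · simp only [integral_dirac, hk]
      simp
    · intro k _
      exact integrable_dirac (by simp)

/-! ### Biased coins -/

/-- The law of `±R` with mean `R * δ`, recentred at its mean. -/
noncomputable def centredCoin (R δ : ℝ) : Measure ℝ :=
  ENNReal.ofReal ((1 + δ) / 2) • Measure.dirac (R - R * δ)
    + ENNReal.ofReal ((1 - δ) / 2) • Measure.dirac (-R - R * δ)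

section Coin

variable {R δ : ℝ}

theorem isProbabilityMeasure_centredCoin (R : ℝ) (hδ : |δ| ≤ 1) :
    IsProbabilityMeasure (centredCoin R δ) := by
  rw [abs_le] at hδ
  refine ⟨?_⟩
  simp only [centredCoin, Measure.add_apply, Measure.smul_apply, measure_univ, smul_eq_mul, mul_one]
  rw [← ENNReal.ofReal_add (by linarith) (by linarith)]
  ring_nf
  simp

theorem integral_centredCoin (R : ℝ) (hδ : |δ| ≤ 1) (f : ℝ → ℝ) :
    ∫ x, f x ∂(centredCoin R δ)
      = (1 + δ) / 2 * f (R - R * δ) + (1 - δ) / 2 * f (-R - R * δ) := by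
  rw [abs_le] at hδ
  have hi : ∀ (c y : ℝ), Integrable f (ENNReal.ofReal c • Measure.dirac y) := fun c y =>
    (integrable_dirac (by simp)).smul_measure ENNReal.ofReal_ne_top
  rw [centredCoin, integral_add_measure (hi _ _) (hi _ _), integral_smul_measure,
    integral_smul_measure, integral_dirac, integral_dirac,
    ENNReal.toReal_ofReal (by linarith), ENNReal.toReal_ofReal (by linarith)]
  simp

theorem lintegral_centredCoin (R δ : ℝ) (f : ℝ → ℝ≥0∞) :
    ∫⁻ x, f x ∂(centredCoin R δ) = ENNReal.ofReal ((1 + δ) / 2) * f (R - R * δ)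
      + ENNReal.ofReal ((1 - δ) / 2) * f (-R - R * δ) := by
  simp [centredCoin, lintegral_add_measure]

theorem integral_id_centredCoin (R : ℝ) (hδ : |δ| ≤ 1) : ∫ x, x ∂(centredCoin R δ) = 0 := by
  rw [integral_centredCoin R hδ]
  ring

/-- Hoeffding's lemma on an interval of length `2 * R`, whatever the bias. -/
theorem hasSubgaussianMGF_centredCoin (R : ℝ≥0) (hδ : |δ| ≤ 1) :
    HasSubgaussianMGF (fun x : ℝ => x) (R ^ 2) (centredCoin R δ) := by
  have := isProbabilityMeasure_centredCoin R hδ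
  have h := hasSubgaussianMGF_of_mem_Icc_of_integral_eq_zero (μ := centredCoin R δ)
    (X := fun x : ℝ => x) (a := -R - R * δ) (b := R - R * δ) aemeasurable_id ?_
    (integral_id_centredCoin R hδ)
  · convert h using 2
    ext
    have : (R : ℝ) - R * δ - (-R - R * δ) = 2 * R := by ring
    simp [this]
  · have hR : (0 : ℝ) ≤ R := R.2
    rw [centredCoin, ae_add_measure_iff]
    constructor <;> refine Measure.ae_smul_measure ?_ _ <;> rw [ae_dirac_eq] <;>
      simp only [Filter.eventually_pure, Set.mem_Icc] <;> constructor <;> linarith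

/-- The left-hand side is the relative entropy of a fair coin with respect to one of bias `δ`,
namely `-log (1 - δ ^ 2) / 2`. -/
theorem neg_half_mul_log_le (h : δ ^ 2 ≤ 1 / 2) (hδ : |δ| < 1) :
    -(1 / 2 * (Real.log (1 + δ) + Real.log (1 - δ))) ≤ δ ^ 2 := by
  rw [abs_lt] at hδ
  have h1 : 0 < 1 - δ ^ 2 := by linarith
  rw [← Real.log_mul (by linarith) (by linarith), show (1 + δ) * (1 - δ) = 1 - δ ^ 2 by ring]
  have h2 := Real.one_sub_inv_le_log_of_pos h1
  have h3 : (1 - δ ^ 2)⁻¹ - 1 ≤ 2 * δ ^ 2 := by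
    rw [sub_le_iff_le_add, inv_le_iff_one_le_mul₀ h1]
    nlinarith [sq_nonneg δ]
  linarith

end Coin

/-- Rewards `±R` that are fair, except for a bias `δ` on block `k`. -/
theorem le_integral_sub_playCount_coin {R δ : ℝ} {d M : ℕ} (hR : 0 < R) (hδ0 : 0 ≤ δ)
    (hδ : δ ^ 2 ≤ 1 / 2)
    (A : BanditAlgorithm (Fin d × Fin M)) (k : Fin d) (T : ℕ) {η : ℝ} (hη : 0 < η)
    [IsProbabilityMeasure (centredCoin R 0)] [IsProbabilityMeasure (centredCoin R δ)] :
    T - ∫ x, playCount (blockArms M k) x ∂(historyLaw A (Kernel.const _ (centredCoin R 0)) T) - T * η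
        - T / η * δ ^ 2 *
          ∫ x, playCount (blockArms M k) x ∂(historyLaw A (Kernel.const _ (centredCoin R 0)) T)
      ≤ ∫ x, (T - playCount (blockArms M k) x) ∂(historyLaw A
          (blockReward (centredCoin R 0) ((centredCoin R δ).map (R * δ + ·)) k) T) := by
  classical
  have hδ1 : δ < 1 := by nlinarith
  have hδabs : |δ| < 1 := by rwa [abs_of_nonneg hδ0]
  have hprob : IsProbabilityMeasure ((centredCoin R δ).map (R * δ + ·)) :=
    Measure.isProbabilityMeasure_map (by fun_prop)
  -- The density of the biased coin with respect to the fair one. Adding the mean back to the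
  -- centred noise puts the rewards at `±R` again, so both laws have the same atoms and only the
  -- sign matters.
  let ℓ : (Fin d × Fin M) × ℝ → ℝ := fun p =>
    if p.1.1 = k then (if 0 < p.2 then 1 + δ else 1 - δ) else 1
  have hℓ : Measurable ℓ := by
    refine Measurable.ite ?_ (Measurable.ite ?_ measurable_const measurable_const) measurable_const
    · exact measurable_fst (Set.toFinite {v : Fin d × Fin M | v.1 = k}).measurableSet
    · exact measurableSet_lt measurable_const measurable_snd
  have hbℓ : ∀ p, 1 - δ ≤ ℓ p := by
    intro p; simp only [ℓ]; split_ifs <;> linarith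
  have hℓC : ∀ p, ℓ p ≤ 1 + δ := by
    intro p; simp only [ℓ]; split_ifs <;> linarith
  have hneg : ¬ 0 < -R := by linarith
  set κ := -(1 / 2 * (Real.log (1 + δ) + Real.log (1 - δ))) with hκdef
  have hκ : ∀ a, ∫ r, -Real.log (ℓ (a, r)) ∂(Kernel.const (Fin d × Fin M) (centredCoin R 0) a)
      = κ * (blockArms M k).indicator 1 a := by
    intro a
    rw [Kernel.const_apply, integral_centredCoin R (by simp)]
    by_cases ha : a.1 = k
    · simp [ℓ, ha, blockArms, hR, hneg, hκdef]
      ring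
    · simp [ℓ, ha, blockArms]
  have hdom : ∀ a, ∀ g : ℝ → ℝ≥0∞, Measurable g →
      ∫⁻ r, ENNReal.ofReal (ℓ (a, r)) * g r ∂(Kernel.const (Fin d × Fin M) (centredCoin R 0) a)
        ≤ ∫⁻ r, g r ∂(blockReward (centredCoin R 0) ((centredCoin R δ).map (R * δ + ·)) k a) := by
    intro a g hg
    change _ ≤ ∫⁻ r, g r
      ∂(if a.1 = k then (centredCoin R δ).map (R * δ + ·) else centredCoin R 0)
    rw [Kernel.const_apply]
    by_cases ha : a.1 = k
    · rw [if_pos ha, lintegral_map hg (by fun_prop), lintegral_centredCoin, lintegral_centredCoin]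
      have e1 : R * δ + (R - R * δ) = R := by ring
      have e2 : R * δ + (-R - R * δ) = -R := by ring
      simp only [e1, e2, mul_zero, sub_zero, add_zero, ℓ, ha, if_true, hR, hneg, if_false,
        ← mul_assoc]
      rw [← ENNReal.ofReal_mul (by norm_num), ← ENNReal.ofReal_mul (by norm_num),
        one_div_mul_eq_div, one_div_mul_eq_div]
    · simp [ℓ, ha]
  refine le_trans ?_ (le_integral_sub_playCount A (Kernel.const _ (centredCoin R 0))
    (blockReward (centredCoin R 0) ((centredCoin R δ).map (R * δ + ·)) k)
    (Set.toFinite (blockArms M k)).measurableSet hℓ (sub_pos.2 hδ1) hbℓ hℓC hdom hκ hη T)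
  have hI : 0 ≤ ∫ x, playCount (blockArms M k) x
      ∂(historyLaw A (Kernel.const _ (centredCoin R 0)) T) :=
    integral_nonneg fun x => playCount_nonneg x
  have := neg_half_mul_log_le hδ hδabs
  gcongr

theorem sum_integral_playCount_blockArms {d M : ℕ} (A : BanditAlgorithm (Fin d × Fin M))
    (ρ : Kernel (Fin d × Fin M) ℝ) [IsMarkovKernel ρ] (T : ℕ) :
    ∑ k, ∫ x, playCount (blockArms M k) x ∂(historyLaw A ρ T) = T := by
  rw [← integral_finsetSum _ fun k _ =>
    integrable_playCount A ρ (Set.toFinite (blockArms M k)).measurableSet T]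
  simp [sum_playCount_blockArms]

/-! ### ### The two regimes and the choice of the gap -/

theorem mainTheorem1 (R : ℝ≥0) (hR : 0 < R) :
    ∃ c : ℝ, 0 < c ∧ ∀ (T d M : ℕ) (lam : ℝ), 1 ≤ T → 2 ≤ d → 0 < lam → (T : ℝ) / d ≤ M →
      ∃ P : SpectralBandit (Fin d × Fin M) R,
        P.graph = blockGraph d M ∧ P.horizon = T ∧ P.reg = lam ∧
        P.effectiveDimension = d ∧
        (∀ᵐ α ∂P.prior, P.graph.smoothness (P.graph.signal α) = 0 ∧
          ∀ v, 0 ≤ P.graph.signal α v ∧ P.graph.signal α v ≤ max 1 √((d : ℝ) / T)) ∧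
        ∀ A : BanditAlgorithm (Fin d × Fin M), c * √((d : ℝ) * T) ≤ P.expectedRegret A := by
  have hR' : (0 : ℝ) < R := hR
  -- The bound `1 / 8` controls the entropy term, and `1 / R` keeps the gap `R * δ` below `√(d /
  -- T)`.
  set c₀ : ℝ := min (1 / 8) (1 / R) with hc₀
  have hc₀0 : 0 < c₀ := lt_min (by norm_num) (by positivity)
  have hc₀8 : c₀ ≤ 1 / 8 := min_le_left _ _
  have hRc₀ : R * c₀ ≤ 1 := by
    calc R * c₀ ≤ R * (1 / R) := by gcongr; exact min_le_right _ _
      _ = 1 := by field_simp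
  refine ⟨R * c₀ / 4, by positivity, fun T d M lam hT hd hlam hM => ?_⟩
  have hd0 : (0 : ℝ) < d := by positivity
  have hd2 : (2 : ℝ) ≤ d := by exact_mod_cast hd
  have hT0 : (0 : ℝ) < T := by positivity
  set q := √((d : ℝ) / T) with hq
  have hq0 : 0 < q := Real.sqrt_pos.2 (by positivity)
  have hqsq : q ^ 2 = d / T := Real.sq_sqrt (by positivity)
  have hqT : √((d : ℝ) * T) = q * T := by
    rw [show (d : ℝ) * T = (d / T) * T ^ 2 by field_simp, Real.sqrt_mul (by positivity),
      Real.sqrt_sq hT0.le]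
  rw [hqT]
  by_cases hcase : 2 * T ≤ d
  · have hcase' : (2 : ℝ) * T ≤ d := by exact_mod_cast hcase
    have hsub : HasSubgaussianMGF (fun x : ℝ => x) (R ^ 2) (Measure.dirac 0) :=
      ⟨fun t => integrable_dirac (by simp), fun t => by
        simp only [mgf, integral_dirac, mul_zero, Real.exp_zero]
        exact Real.one_le_exp (by positivity)⟩
    obtain ⟨P, h1, h2, h3, h4, h5, h6⟩ := exists_spectralBandit_blockGraph (M := M) hT
      (by omega : 1 ≤ d) hlam hM hq0 (Measure.dirac 0) (Measure.dirac 0) (by simp) (by simp)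
      hsub hsub
    refine ⟨P, h1, h2, h3, h4, ?_, fun A => ?_⟩
    · filter_upwards [h5] with α hα
      exact ⟨hα.1, fun v => ⟨(hα.2 v).1, (hα.2 v).2.trans (le_max_right _ _)⟩⟩
    · have hprob : IsProbabilityMeasure ((Measure.dirac (0 : ℝ)).map (q + ·)) :=
        Measure.isProbabilityMeasure_map (by fun_prop)
      have hk : ∀ k, T - T * ∫ x, playCount (blockArms M k) x
            ∂(historyLaw A (Kernel.const _ (Measure.dirac 0)) T)
          ≤ ∫ x, (T - playCount (blockArms M k) x) ∂(historyLaw A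
            (blockReward (Measure.dirac 0) ((Measure.dirac 0).map (q + ·)) k) T) := by
        intro k
        refine le_integral_sub_playCount_of_eq_off A _ _
          (Set.toFinite (blockArms M k)).measurableSet (fun a ha => ?_) T
        exact (if_neg ha).symm
      have hsum := Finset.sum_le_sum fun k (_ : k ∈ Finset.univ) => hk k
      rw [Finset.sum_sub_distrib, ← Finset.mul_sum, sum_integral_playCount_blockArms] at hsum
      simp only [Finset.sum_const, Finset.card_univ, Fintype.card_fin, nsmul_eq_mul] at hsum
      rw [h6 A, ← Finset.mul_sum]
      -- Here `T ≤ d / 2`, so on average over the blocks at least half of the rounds miss the good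
      -- block.
      calc R * c₀ / 4 * (q * T) ≤ 1 / 2 * (q * T) := by gcongr; linarith
        _ = (d : ℝ)⁻¹ * (q * (d * T - d / 2 * T)) := by field_simp; ring
        _ ≤ (d : ℝ)⁻¹ * (q * (d * T - T * T)) := by gcongr; linarith
        _ ≤ _ := by gcongr
  · have hcase' : (d : ℝ) ≤ 2 * T := by exact_mod_cast (not_le.1 hcase).le
    set δ := c₀ * q with hδ
    have hδ0 : 0 < δ := by positivity
    have hδsq : δ ^ 2 ≤ d / (64 * T) := by
      rw [hδ, mul_pow, hqsq]
      calc c₀ ^ 2 * ((d : ℝ) / T) ≤ (1 / 8) ^ 2 * ((d : ℝ) / T) := by gcongr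
        _ = (d : ℝ) / (64 * T) := by ring
    have hδhalf : δ ^ 2 ≤ 1 / 2 := by
      refine hδsq.trans ?_
      rw [div_le_iff₀ (by positivity)]
      linarith
    have hδ1 : |δ| ≤ 1 := by
      rw [abs_of_pos hδ0]
      nlinarith
    have h01 : |(0 : ℝ)| ≤ 1 := by simp
    have := isProbabilityMeasure_centredCoin R hδ1
    have := isProbabilityMeasure_centredCoin R h01
    obtain ⟨P, h1, h2, h3, h4, h5, h6⟩ := exists_spectralBandit_blockGraph (M := M) hT
      (by omega : 1 ≤ d) hlam hM (mul_pos hR' hδ0) (centredCoin R 0) (centredCoin R δ)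
      (integral_id_centredCoin R h01) (integral_id_centredCoin R hδ1)
      (hasSubgaussianMGF_centredCoin R h01) (hasSubgaussianMGF_centredCoin R hδ1)
    refine ⟨P, h1, h2, h3, h4, ?_, fun A => ?_⟩
    · have hle : R * δ ≤ q := by
        rw [hδ, ← mul_assoc]
        exact mul_le_of_le_one_left hq0.le hRc₀
      filter_upwards [h5] with α hα
      exact ⟨hα.1, fun v => ⟨(hα.2 v).1, ((hα.2 v).2.trans hle).trans (le_max_right _ _)⟩⟩
    · have hsum := Finset.sum_le_sum fun k (_ : k ∈ Finset.univ) =>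
        le_integral_sub_playCount_coin hR' hδ0.le hδhalf A k T (η := 1 / 8) (by norm_num)
      simp only [Finset.sum_sub_distrib, ← Finset.mul_sum, sum_integral_playCount_blockArms,
        Finset.sum_const, Finset.card_univ, Fintype.card_fin, nsmul_eq_mul] at hsum
      -- The three losses are at most `d * T / 2` (from `d ≥ 2`), `d * T / 8` (from `η = 1 / 8`) and
      -- `d * T / 8` (from `δ ^ 2 ≤ d / (64 * T)`), which leaves a quarter.
      have hlow : (d : ℝ) * T / 4 ≤ d * T - T - T * (d * (1 / 8)) - T / (1 / 8) * δ ^ 2 * T := by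
        have e1 : (T : ℝ) / (1 / 8) * δ ^ 2 * T ≤ T / (1 / 8) * (d / (64 * T)) * T := by gcongr
        have e2 : (T : ℝ) / (1 / 8) * (d / (64 * T)) * T = d * T / 8 := by field_simp; norm_num
        nlinarith
      rw [h6 A, ← Finset.mul_sum]
      calc R * c₀ / 4 * (q * T) = (d : ℝ)⁻¹ * (R * δ * (d * T / 4)) := by rw [hδ]; field_simp
        _ ≤ _ := by gcongr; exact hlow.trans hsum
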